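/- All graphs are finite and simple, and $\log$ denotes $\log_2$. A graph is $d$-degenerate if its vertices can be ordered $v_1,\dots,v_n$ so that each $v_i$ is adjacent to at most $d$ of the vertices $v_1,\dots,v_{i-1}$. The chromatic index $\chi'(G)$ is the smallest $k$ such that the edges of $G$ can be coloured with at most $k$ colours so that any two distinct edges sharing an endpoint get different colours. In online edge colouring the input is a sequence $e_1,\dots,e_m$ of the edges of a graph $G$, given by their endpoints; the algorithm does not know the graph in advance. In the advice-with-request model with $b$ bits per edge, an oracle that knows the entire input provides a string $b_i\in\{0,1\}^b$ along with each edge $e_i$, and the algorithm irrevocably chooses the colour of $e_i$ as a function of $e_1,\dots,e_i$ and $b_1,\dots,b_i$ only. **Theorem.** Let $d\ge 1$ be an integer. There are an online edge-colouring algorithm and an oracle in the advice-with-request model, with $$1+\lceil\log (2d)\rceil+\lceil\log (d+1)\rceil = O(\log d)\qquad (d\to\infty)$$ advice bits per edge, which on every input sequence of the edges of a $d$-degenerate graph $G$ produce an optimal edge colouring, that is, one in which any two distinct edges sharing an endpoint get different colours and the set of colours used is $\{1,\dots,\chi'(G)\}$. Hence the total number of advice bits on an input with $m$ edges is $m\,(1+\lceil\log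 (2d)\rceil+\lceil\log (d+1)\rceil)=O(m\log d)$; that is, there is an absolute constant $C$ such that it is at most $C\,m\log d$ for all $d\ge 2$ and all $m$. -/

import Mathlib

universe u

namespace OnlineEdgeColoring

section Graphs

variable {V : Type u}

/-- `G` is `d`-degenerate: its vertices can be ordered as `v₁, …, vₙ` so that every `vᵢ` is adjacent
to at most `d` of its predecessors.  The graphs considered have finitely many edges but may live on
an infinite type `V` of potential vertices, so the ordering has to list all non-isolated elements of
`V` (and may list any finite number of isolated ones). -/
def IsDegenerate (G : SimpleGraph V) (d : ℕ) : Prop :=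
  ∃ (n : ℕ) (v : Fin n → V), Function.Injective v ∧ (∀ x ∈ G.support, x ∈ Set.range v) ∧
    ∀ i : Fin n, {j : Fin n | j < i ∧ G.Adj (v i) (v j)}.ncard ≤ d

/-- `G` is `k`-edge-colourable: its edges can be coloured with at most `k` colours so that distinct
edges sharing an endpoint get distinct colours. -/
def EdgeColorable (G : SimpleGraph V) (k : ℕ) : Prop :=
  ∃ c : G.edgeSet → Fin k, ∀ e f : G.edgeSet, e ≠ f →
    (∃ x : V, x ∈ (e : Sym2 V) ∧ x ∈ (f : Sym2 V)) → c e ≠ c f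

/-- The chromatic index `χ'(G)`: the smallest `k` such that `G` is `k`-edge-colourable (such a `k`
exists for every graph with finitely many edges). -/
noncomputable def chromaticIndex (G : SimpleGraph V) : ℕ :=
  sInf {k : ℕ | EdgeColorable G k}

end Graphs

section Inputs

variable {V : Type u} {m : ℕ}

/-- The inputs of online edge colouring: sequences `e₁, …, eₘ` of pairwise distinct two-element
subsets of `V`, i.e. the edges of a finite simple graph in order of arrival. -/
def IsInput (σ : Fin m → Sym2 V) : Prop :=
  Function.Injective σ ∧ ∀ i, ¬ (σ i).IsDiag

/-- The graph whose edges are the members of the sequence. -/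
def inputGraph (σ : Fin m → Sym2 V) : SimpleGraph V :=
  SimpleGraph.fromEdgeSet (Set.range σ)

/-- `c` (where `c i` is the colour of the `i`-th edge) is an optimal edge colouring: edges sharing
an endpoint get different colours, and the colours used are exactly `1, 2, …, χ'`. -/
def IsOptimalColoring (σ : Fin m → Sym2 V) (c : Fin m → ℕ) : Prop :=
  (∀ i j : Fin m, i ≠ j → (∃ x : V, x ∈ σ i ∧ x ∈ σ j) → c i ≠ c j) ∧
    Set.range c = Set.Icc 1 (chromaticIndex (inputGraph σ))

end Inputs

/-- An online edge-colouring algorithm, together with its oracle, in the advice-with-request model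
with `b` advice bits per edge; `V` is the set of potential vertices. -/
structure AdviceAlgorithm (V : Type u) (b : ℕ) where
  /-- The decision rule.  When an edge arrives, its colour is a function of the edges revealed so
  far (including the current one) and of the advice strings received so far. -/
  rule : (i : ℕ) → (Fin (i + 1) → Sym2 V) → (Fin (i + 1) → (Fin b → Bool)) → ℕ
  /-- The oracle, which knows the entire input, and provides `b` bits for each edge. -/
  oracle : (m : ℕ) → (Fin m → Sym2 V) → Fin m → (Fin b → Bool)

namespace AdviceAlgorithm

variable {V : Type u} {b m : ℕ}

/-- The colour that the algorithm gives to the `i`-th edge of the input `σ`: the decision rule is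
applied to the initial segments, up to the `i`-th member, of `σ` and of the advice. -/
def color (A : AdviceAlgorithm V b) (σ : Fin m → Sym2 V) (i : Fin m) : ℕ :=
  A.rule i (fun j => σ (Fin.castLE i.isLt j)) (fun j => A.oracle m σ (Fin.castLE i.isLt j))

/-- All advice bits provided on the input `σ`, concatenated. -/
def advice (A : AdviceAlgorithm V b) (σ : Fin m → Sym2 V) : List Bool :=
  (List.ofFn fun i => List.ofFn (A.oracle m σ i)).flatten

end AdviceAlgorithm

/-- The number `1 + ⌈log₂ (2d)⌉ + ⌈log₂ (d + 1)⌉`. -/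
noncomputable def adviceBits (d : ℕ) : ℕ :=
  1 + ⌈Real.logb 2 (2 * (d : ℝ))⌉₊ + ⌈Real.logb 2 ((d : ℝ) + 1)⌉₊

end OnlineEdgeColoring

namespace OnlineEdgeColoring

/-! Take the smaller endpoint of an edge, in a degenerate ordering, as its tail; at most `d` edges
at a vertex then have their tail elsewhere. For `d ≥ 2` put `c = 2 * d` and split the edges into
groups of maximum degree at most `c`: every vertex deals out the edges whose tail it is in order of
arrival, `c` to a group, less the places taken by its other edges. At most `d ≤ c` places are lost
in all, so an edge preceded by `p` edges with the same tail lands in group `p / c` or `p / c + 1`.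
Two bits, one for the tail and one for this alternative, give the group.

Each group is still `d`-degenerate, and a Vizing-type recolouring argument (`exists_isProperOn`)
colours such a graph with `k` colours whenever `k` is at least `2 * d` and the maximum degree. To
use exactly `χ' ≥ 2 * d` colours, write `χ' = c * Q + h` with `2 * d ≤ h < 4 * d`. The groups below
`Q` own `c` colours each; all other edges form a graph of maximum degree at most `h`
(`card_overflow_le`) and share the last `h` colours. If `χ' < 2 * d`, an optimal colouring is
transmitted directly.

Decoding works online (`Scheme.color_eq_of_code_eq`): along a fixed tail the groups never decrease,
so every edge that counts towards `p` has announced its tail, and an overflow edge is preceded by an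
edge of group `Q - 1`, which reveals `Q`. There are `4 * c + 2 * c` codes, few enough for `d ≥ 2`;
for `d = 1` groups of size `c = 1`, that is matchings, do the job. -/

open scoped Classical in
/-- In a finite graph of maximum degree two, no component has three vertices of degree at most
one. -/
theorem not_reachable_of_three_ends {V : Type*} [Fintype V] (H : SimpleGraph V)
    (h2 : ∀ x, H.degree x ≤ 2) {u w x : V} (huw : u ≠ w) (hux : u ≠ x) (hwx : w ≠ x)
    (hu : H.degree u ≤ 1) (hw : H.degree w ≤ 1) (hx : H.degree x ≤ 1)
    (h : H.Reachable u w) : ¬ H.Reachable u x := by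
  intro h'
  set C := H.connectedComponentMk u with hC
  set K := H.induce C.supp with hK
  have hconn : K.Connected := C.connected_toSimpleGraph
  have hcard := hconn.card_vert_le_card_edgeSet_add_one
  rw [Nat.card_eq_fintype_card, Nat.card_eq_fintype_card, ← SimpleGraph.edgeFinset_card] at hcard
  have hsum := K.sum_degrees_eq_twice_card_edges
  have hdeg : ∀ v : C.supp, K.degree v ≤ H.degree v := by
    intro v
    rw [← SimpleGraph.card_neighborFinset_eq_degree, ← SimpleGraph.card_neighborFinset_eq_degree]
    refine Finset.card_le_card_of_injOn (fun y => (y : V)) ?_ Subtype.val_injective.injOn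
    intro y hy
    simpa [hK] using hy
  have huC : u ∈ C.supp := by simp [hC]
  have hwC : w ∈ C.supp := by
    rw [SimpleGraph.ConnectedComponent.mem_supp_iff, hC, SimpleGraph.ConnectedComponent.eq]
    exact h.symm
  have hxC : x ∈ C.supp := by
    rw [SimpleGraph.ConnectedComponent.mem_supp_iff, hC, SimpleGraph.ConnectedComponent.eq]
    exact h'.symm
  set T : Finset C.supp := {⟨u, huC⟩, ⟨w, hwC⟩, ⟨x, hxC⟩} with hT
  have hT3 : T.card = 3 := by
    rw [hT, Finset.card_eq_three]
    exact ⟨_, _, _, by simpa using huw, by simpa using hux, by simpa using hwx, rfl⟩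
  -- With `n` vertices and `e` edges in the component this says `2 * e + 3 ≤ 2 * n`, whereas
  -- connectedness gives `n ≤ e + 1`.
  have hle : ∑ v : C.supp, (K.degree v + if v ∈ T then 1 else 0) ≤ ∑ _v : C.supp, 2 := by
    refine Finset.sum_le_sum fun v _ => ?_
    split_ifs with hv
    · have : H.degree (v : V) ≤ 1 := by
        simp only [hT, Finset.mem_insert, Finset.mem_singleton] at hv
        rcases hv with rfl | rfl | rfl <;> assumption
      have := hdeg v
      omega
    · have := hdeg v
      have := h2 v
      omega
  rw [Finset.sum_add_distrib, hsum, Finset.sum_ite_mem, Finset.univ_inter, Finset.sum_const,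
    Finset.sum_const, hT3, Finset.card_univ] at hle
  simp only [smul_eq_mul] at hle
  omega

/-! ### A Vizing-type theorem for degenerate graphs -/

section Vizing

variable {V : Type*}

/-- `f` properly colours the edges of `G` with colours less than `k`. -/
def IsProperOn (G : SimpleGraph V) (k : ℕ) (f : Sym2 V → ℕ) : Prop :=
  (∀ x y, G.Adj x y → f s(x, y) < k) ∧
    ∀ x y z, G.Adj x y → G.Adj x z → f s(x, y) = f s(x, z) → y = z

/-- No edge of `G` at `x` has colour `a`. -/
def IsMissingAt (G : SimpleGraph V) (f : Sym2 V → ℕ) (x : V) (a : ℕ) : Prop :=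
  ∀ y, G.Adj x y → f s(x, y) ≠ a

/-- The subgraph of `G` formed by the edges of colour `a` or `b`. -/
def chainGraph (G : SimpleGraph V) (f : Sym2 V → ℕ) (a b : ℕ) : SimpleGraph V where
  Adj x y := G.Adj x y ∧ (f s(x, y) = a ∨ f s(x, y) = b)
  symm := ⟨fun x y h => ⟨h.1.symm, by rw [Sym2.eq_swap]; exact h.2⟩⟩
  loopless := ⟨fun x h => G.irrefl h.1⟩

open scoped Classical in
/-- Exchanging the two colours on one component of a two-coloured subgraph. -/
theorem IsProperOn.exists_swap {G : SimpleGraph V} {k : ℕ} {f : Sym2 V → ℕ}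
    (hf : IsProperOn G k f) {a b : ℕ} (ha : a < k) (hb : b < k) (r : V) :
    ∃ f', IsProperOn G k f' ∧
      (∀ x y, G.Adj x y → (chainGraph G f a b).Reachable r x →
        f' s(x, y) = Equiv.swap a b (f s(x, y))) ∧
      ∀ x y, G.Adj x y → ¬ (chainGraph G f a b).Reachable r x → f' s(x, y) = f s(x, y) := by
  set H := chainGraph G f a b with hH
  -- One endpoint in the component suffices as the criterion: an edge of colour `a` or `b` has both
  -- or neither of its ends there, and the swap fixes all other colours.
  set f' : Sym2 V → ℕ := fun e =>
    if ∃ x, x ∈ e ∧ H.Reachable r x then Equiv.swap a b (f e) else f e with hf'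
  have h1 : ∀ x y, G.Adj x y → H.Reachable r x → f' s(x, y) = Equiv.swap a b (f s(x, y)) := by
    intro x y _ hx
    exact if_pos ⟨x, by simp, hx⟩
  have h2 : ∀ x y, G.Adj x y → ¬ H.Reachable r x → f' s(x, y) = f s(x, y) := by
    intro x y hxy hx
    by_cases hc : f s(x, y) = a ∨ f s(x, y) = b
    · have hadj : H.Adj x y := ⟨hxy, hc⟩
      refine if_neg ?_
      rintro ⟨z, hz, hrz⟩
      rcases Sym2.mem_iff.1 hz with rfl | rfl
      · exact hx hrz
      · exact hx (hrz.trans hadj.symm.reachable)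
    · push Not at hc
      simp only [hf']
      rw [Equiv.swap_apply_of_ne_of_ne hc.1 hc.2, ite_self]
  refine ⟨f', ⟨?_, ?_⟩, h1, h2⟩
  · intro x y hxy
    have := hf.1 x y hxy
    by_cases hx : H.Reachable r x
    · rw [h1 x y hxy hx, Equiv.swap_apply_def]
      split_ifs <;> assumption
    · rwa [h2 x y hxy hx]
  · intro x y z hxy hxz h
    by_cases hx : H.Reachable r x
    · rw [h1 x y hxy hx, h1 x z hxz hx] at h
      exact hf.2 x y z hxy hxz ((Equiv.swap a b).injective h)
    · rw [h2 x y hxy hx, h2 x z hxz hx] at h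
      exact hf.2 x y z hxy hxz h

open scoped Classical in
/-- A colouring of `G - uw` extends to `G` if some colour is missing at both ends of `uw`. -/
theorem IsProperOn.extend {G : SimpleGraph V} {k : ℕ} {f : Sym2 V → ℕ} {u w : V}
    (hf : IsProperOn (G.deleteEdges {s(u, w)}) k f) {a : ℕ} (ha : a < k)
    (hu : IsMissingAt (G.deleteEdges {s(u, w)}) f u a)
    (hw : IsMissingAt (G.deleteEdges {s(u, w)}) f w a) :
    IsProperOn G k (Function.update f s(u, w) a) := by
  have hadj : ∀ x y, G.Adj x y → s(x, y) ≠ s(u, w) → (G.deleteEdges {s(u, w)}).Adj x y :=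
    fun x y h hne => by simpa using ⟨h, by simpa using hne⟩
  have hmiss : ∀ x y z, G.Adj x z → s(x, y) = s(u, w) → s(x, z) ≠ s(u, w) →
      f s(x, z) ≠ a := by
    intro x y z hxz hy hz
    rcases Sym2.eq_iff.1 hy with ⟨rfl, rfl⟩ | ⟨rfl, rfl⟩
    · exact hu z (hadj _ _ hxz hz)
    · exact hw z (hadj _ _ hxz hz)
  constructor
  · intro x y hxy
    by_cases he : s(x, y) = s(u, w)
    · rwa [he, Function.update_self]
    · rw [Function.update_of_ne he]
      exact hf.1 _ _ (hadj _ _ hxy he)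
  · intro x y z hxy hxz h
    by_cases hy : s(x, y) = s(u, w) <;> by_cases hz : s(x, z) = s(u, w)
    · exact Sym2.congr_right.1 (hy.trans hz.symm)
    · rw [hy, Function.update_self, Function.update_of_ne hz] at h
      exact absurd h.symm (hmiss x y z hxz hy hz)
    · rw [hz, Function.update_self, Function.update_of_ne hy] at h
      exact absurd h (hmiss x z y hxy hz hy)
    · rw [Function.update_of_ne hy, Function.update_of_ne hz] at h
      exact hf.2 x y z (hadj _ _ hxy hy) (hadj _ _ hxz hz) h

/-- Recolouring an edge with a colour that is missing at both of its ends. -/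
theorem IsProperOn.recolor [DecidableEq V] {G : SimpleGraph V} {k : ℕ} {f : Sym2 V → ℕ} {u w : V}
    (hf : IsProperOn G k f) {a : ℕ} (ha : a < k) (hu : IsMissingAt G f u a)
    (hw : IsMissingAt G f w a) :
    IsProperOn G k (Function.update f s(u, w) a) := by
  have hle : G.deleteEdges {s(u, w)} ≤ G := SimpleGraph.deleteEdges_le _
  have := IsProperOn.extend (G := G) (u := u) (w := w) (f := f)
    ⟨fun x y h => hf.1 x y (hle h), fun x y z h h' => hf.2 x y z (hle h) (hle h')⟩ ha
    (fun y h => hu y (hle h)) (fun y h => hw y (hle h))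
  convert this

variable [Fintype V]

open scoped Classical in
/-- The colours less than `k` that are missing at `x`. -/
noncomputable def missing (G : SimpleGraph V) (k : ℕ) (f : Sym2 V → ℕ) (x : V) : Finset ℕ :=
  {a ∈ Finset.range k | IsMissingAt G f x a}

open scoped Classical in
theorem le_card_missing_add_degree (G : SimpleGraph V) (k : ℕ) (f : Sym2 V → ℕ) (x : V) :
    k ≤ (missing G k f x).card + G.degree x := by
  have h : Finset.range k ⊆
      missing G k f x ∪ (G.neighborFinset x).image (fun y => f s(x, y)) := by
    intro a ha
    by_cases hm : IsMissingAt G f x a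
    · exact Finset.mem_union_left _ (by simpa [missing] using ⟨by simpa using ha, hm⟩)
    · refine Finset.mem_union_right _ ?_
      simp only [IsMissingAt] at hm
      push Not at hm
      simpa using hm
  calc k = (Finset.range k).card := by simp
    _ ≤ _ := Finset.card_le_card h
    _ ≤ _ := Finset.card_union_le _ _
    _ ≤ _ := by
      gcongr
      exact Finset.card_image_le

open scoped Classical in
theorem chainGraph_degree_le {G : SimpleGraph V} {k : ℕ} {f : Sym2 V → ℕ}
    (hf : IsProperOn G k f) (a b : ℕ) (x : V) : (chainGraph G f a b).degree x ≤ 2 := by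
  rw [← SimpleGraph.card_neighborFinset_eq_degree]
  refine (Finset.card_le_card_of_injOn (t := {a, b}) (fun y => f s(x, y)) ?_ ?_).trans
    Finset.card_le_two
  · intro y hy
    have : (chainGraph G f a b).Adj x y := by simpa using hy
    simpa using this.2
  · intro y hy z hz h
    have hy : (chainGraph G f a b).Adj x y := by simpa using hy
    have hz : (chainGraph G f a b).Adj x z := by simpa using hz
    exact hf.2 x y z hy.1 hz.1 h

open scoped Classical in
theorem chainGraph_degree_le_one {G : SimpleGraph V} {k : ℕ} {f : Sym2 V → ℕ}
    (hf : IsProperOn G k f) {a b : ℕ} {x : V} (h : IsMissingAt G f x a ∨ IsMissingAt G f x b) :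
    (chainGraph G f a b).degree x ≤ 1 := by
  rw [← SimpleGraph.card_neighborFinset_eq_degree, Finset.card_le_one]
  intro y hy z hz
  have hy : (chainGraph G f a b).Adj x y := by simpa using hy
  have hz : (chainGraph G f a b).Adj x z := by simpa using hz
  refine hf.2 x y z hy.1 hz.1 ?_
  have h1 := hy.2
  have h2 := hz.2
  rcases h with h | h
  · have := h y hy.1
    have := h z hz.1
    grind
  · have := h y hy.1
    have := h z hz.1
    grind

open scoped Classical in
/-- Extending a colouring from `G - uw` to `G`. -/
theorem exists_isProperOn_of_deleteEdge {G : SimpleGraph V} {d k : ℕ} (hk : 2 * d ≤ k)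
    (hdeg : ∀ x, G.degree x ≤ k) {u w : V} (huw : G.Adj u w) (hw : G.degree w ≤ d)
    (hu : {x ∈ G.neighborFinset u | d < G.degree x}.card ≤ d) {f : Sym2 V → ℕ}
    (hf : IsProperOn (G.deleteEdges {s(u, w)}) k f) : ∃ f', IsProperOn G k f' := by
  obtain ⟨G', hG'⟩ : ∃ G', G' = G.deleteEdges {s(u, w)} := ⟨_, rfl⟩
  rw [← hG'] at hf
  have hadj : ∀ x y, G'.Adj x y → G.Adj x y := fun x y h => by
    rw [hG'] at h
    exact SimpleGraph.deleteEdges_le _ h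
  have hsub : ∀ x, G'.neighborFinset x ⊆ G.neighborFinset x := fun x y hy => by
    simpa using hadj x y (by simpa using hy)
  have hle : ∀ x, G'.degree x ≤ G.degree x := fun x => Finset.card_le_card (hsub x)
  have hlt : ∀ x y, s(x, y) = s(u, w) → G.Adj x y → G'.degree x < G.degree x := by
    intro x y he hxy
    refine Finset.card_lt_card (Finset.ssubset_iff_subset_ne.2 ⟨hsub x, fun h => ?_⟩)
    have : y ∈ G'.neighborFinset x := by rw [h]; simpa using hxy
    simp [hG', he] at this
  have hltu := hlt u w rfl huw
  have hltw := hlt w u Sym2.eq_swap huw.symm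
  have hMw := le_card_missing_add_degree G' k f w
  obtain ⟨α, hα⟩ : (missing G' k f u).Nonempty := by
    rw [← Finset.card_pos]
    have := le_card_missing_add_degree G' k f u
    have := hdeg u
    omega
  obtain ⟨hαk, hαu⟩ : α < k ∧ IsMissingAt G' f u α := by simpa [missing] using hα
  by_cases hcommon : ∃ a < k, IsMissingAt G' f u a ∧ IsMissingAt G' f w a
  · obtain ⟨a, ha, h1, h2⟩ := hcommon
    exact ⟨_, IsProperOn.extend (hG' ▸ hf) ha (hG' ▸ h1) (hG' ▸ h2)⟩
  push Not at hcommon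
  -- a colour missing at `w` leads from `u` to a vertex of small degree
  have hβ : ∀ b ∈ missing G' k f w, ∃ y, G'.Adj u y ∧ f s(u, y) = b := by
    intro b hb
    obtain ⟨hbk, hbw⟩ : b < k ∧ IsMissingAt G' f w b := by simpa [missing] using hb
    by_contra hcon
    push Not at hcon
    exact hcommon b hbk hcon hbw
  have : Nonempty V := ⟨u⟩
  choose! nb hnb hnbf using hβ
  -- At least `k - (d - 1) > d` colours are missing at `w`; they lead to distinct neighbours of `u`,
  -- at most `d` of which have degree above `d`.
  obtain ⟨β, hβ, hβd⟩ : ∃ b ∈ missing G' k f w, G.degree (nb b) ≤ d := by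
    by_contra hcon
    push Not at hcon
    have : (missing G' k f w).card ≤ {x ∈ G.neighborFinset u | d < G.degree x}.card := by
      refine Finset.card_le_card_of_injOn nb ?_ ?_
      · intro b hb
        simpa using ⟨hadj _ _ (hnb b hb), hcon b hb⟩
      · intro b hb b' hb' h
        rw [← hnbf b hb, ← hnbf b' hb', h]
    omega
  set x := nb β with hxdef
  have hux := hnb β hβ
  have huxβ := hnbf β hβ
  rw [← hxdef] at hux huxβ
  obtain ⟨hβk, hβw⟩ : β < k ∧ IsMissingAt G' f w β := by simpa [missing] using hβ
  -- At least `k - d + 1` colours are missing at `w` and `k - d` at `x`, together more than `k`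
  -- since `k ≥ 2 * d`.
  obtain ⟨δ, hδ⟩ : (missing G' k f w ∩ missing G' k f x).Nonempty := by
    rw [← Finset.card_pos]
    have h1 := le_card_missing_add_degree G' k f x
    have h2 := hle x
    have h3 := Finset.card_union_add_card_inter (missing G' k f w) (missing G' k f x)
    have h4 : (missing G' k f w ∪ missing G' k f x).card ≤ k := by
      refine (Finset.card_le_card (t := Finset.range k) ?_).trans (by simp)
      exact Finset.union_subset (Finset.filter_subset _ _) (Finset.filter_subset _ _)
    omega
  obtain ⟨⟨hδk, hδw⟩, -, hδx⟩ :
      (δ < k ∧ IsMissingAt G' f w δ) ∧ δ < k ∧ IsMissingAt G' f x δ := by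
    simpa [missing] using hδ
  have hβα : β ≠ α := fun h => hαu x hux (huxβ.trans h)
  have hβδ : β ≠ δ := fun h => hδx u hux.symm (by rw [Sym2.eq_swap]; exact huxβ.trans h)
  have hwx : w ≠ x := by
    rintro hwx
    rw [← hwx] at hux
    simp [hG'] at hux
  -- exchange `α` and `δ` on a component
  have key : ∀ r, IsMissingAt G' f r δ → ¬ (chainGraph G' f α δ).Reachable r u →
      ∃ f', IsProperOn G' k f' ∧ IsMissingAt G' f' r α ∧ (∀ y, G'.Adj u y → f' s(u, y) = f s(u, y)) ∧
        ∀ z, ¬ (chainGraph G' f α δ).Reachable r z → ∀ y, G'.Adj z y → f' s(z, y) = f s(z, y) := by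
    intro r hr hru
    obtain ⟨f', hf', h1, h2⟩ := hf.exists_swap hαk hδk r
    refine ⟨f', hf', fun y hy h => ?_, fun y hy => h2 u y hy hru, fun z hz y hy => h2 z y hy hz⟩
    rw [h1 r y hy (SimpleGraph.Reachable.refl r), Equiv.swap_apply_eq_iff,
      Equiv.swap_apply_left] at h
    exact hr y hy h
  -- Since `α` is missing at `u` and `δ` at `w` and `x`, all three have degree at most one in the
  -- chain graph, so `w` and `x` are not both in the component of `u`.
  by_cases hreach : (chainGraph G' f α δ).Reachable w u
  · have hxu : ¬ (chainGraph G' f α δ).Reachable x u := fun h =>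
      not_reachable_of_three_ends (chainGraph G' f α δ) (chainGraph_degree_le hf α δ)
        huw.ne hux.ne hwx (chainGraph_degree_le_one hf (Or.inl hαu))
        (chainGraph_degree_le_one hf (Or.inr hδw)) (chainGraph_degree_le_one hf (Or.inr hδx))
        hreach.symm h.symm
    obtain ⟨f', hf', hx, hu', hz⟩ := key x hδx hxu
    have hw' := hz w fun h => hxu (h.trans hreach)
    have hαu' : IsMissingAt G' f' u α := fun y hy h => hαu y hy ((hu' y hy).symm.trans h)
    have hβw' : IsMissingAt G' f' w β := fun y hy h => hβw y hy ((hw' y hy).symm.trans h)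
    -- Giving `ux` the colour `α` frees `β` at `u`; as `β` is still missing at `w`, it can colour
    -- `uw`.
    have hrec := hf'.recolor hαk hαu' hx
    rw [hG'] at hrec
    refine ⟨_, hrec.extend hβk ?_ ?_⟩
    all_goals rw [← hG']
    · intro y hy
      by_cases hyx : y = x
      · rw [hyx, Function.update_self]
        exact hβα.symm
      · rw [Function.update_of_ne fun h => hyx (Sym2.congr_right.1 h), hu' y hy]
        exact fun h => hyx (hf.2 u y x hy hux (h.trans huxβ.symm))
    · intro y hy
      have hne : s(w, y) ≠ s(u, x) := by
        intro h
        rcases Sym2.eq_iff.1 h with ⟨h, -⟩ | ⟨h, -⟩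
        · exact huw.ne h.symm
        · exact hwx h
      rw [Function.update_of_ne hne]
      exact hβw' y hy
  · obtain ⟨f', hf', hw', hu', -⟩ := key w hδw hreach
    have hαu' : IsMissingAt G' f' u α := fun y hy h => hαu y hy ((hu' y hy).symm.trans h)
    exact ⟨_, IsProperOn.extend (hG' ▸ hf') hαk (hG' ▸ hαu') (hG' ▸ hw')⟩

open scoped Classical in
/-- A graph with an ordering in which every vertex has at most `d` smaller neighbours is
edge-colourable with `k` colours if `k` is at least `2 d` and at least the maximum degree. -/
theorem exists_isProperOn [LinearOrder V] (d k : ℕ) (hk : 2 * d ≤ k) (G : SimpleGraph V)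
    (hd : ∀ x, {y ∈ G.neighborFinset x | y < x}.card ≤ d) (hdeg : ∀ x, G.degree x ≤ k) :
    ∃ f, IsProperOn G k f := by
  induction hn : G.edgeFinset.card generalizing G with
  | zero =>
    have hG : ∀ x y, ¬ G.Adj x y := by
      intro x y h
      have : s(x, y) ∈ G.edgeFinset := by simpa using h
      simp [Finset.card_eq_zero.1 hn] at this
    exact ⟨fun _ => 0, fun x y h => (hG x y h).elim, fun x y z h => (hG x y h).elim⟩
  | succ n ih =>
    obtain ⟨u, w, huw, hw, hu⟩ : ∃ u w, G.Adj u w ∧ G.degree w ≤ d ∧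
        {x ∈ G.neighborFinset u | d < G.degree x}.card ≤ d := by
      by_cases hS : (Finset.univ.filter fun x => d < G.degree x).Nonempty
      -- The neighbours of degree above `d` of the largest such vertex `u` precede it, so there are
      -- at most `d` of them and some other neighbour serves as `w`.
      · obtain ⟨u, hu, hmax⟩ := Finset.exists_max_image _ id hS
        simp only [Finset.mem_filter, Finset.mem_univ, true_and, id] at hu hmax
        have hbig : {x ∈ G.neighborFinset u | d < G.degree x}.card ≤ d := by
          refine (Finset.card_le_card ?_).trans (hd u)
          intro x hx
          simp only [Finset.mem_filter, SimpleGraph.mem_neighborFinset] at hx ⊢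
          exact ⟨hx.1, lt_of_le_of_ne (hmax x hx.2) hx.1.ne'⟩
        by_contra! hcon
        have : G.neighborFinset u ⊆ {x ∈ G.neighborFinset u | d < G.degree x} := by
          intro x hx
          simp only [Finset.mem_filter]
          refine ⟨hx, ?_⟩
          by_contra hxd
          exact absurd hbig (not_le.2 (hcon u x (by simpa using hx) (not_lt.1 hxd)))
        have := Finset.card_le_card this
        rw [SimpleGraph.card_neighborFinset_eq_degree] at this
        omega
      · simp only [Finset.not_nonempty_iff_eq_empty, Finset.filter_eq_empty_iff, Finset.mem_univ,
          true_implies, not_lt] at hS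
        replace hS : ∀ x, G.degree x ≤ d := fun x => hS (x := x)
        obtain ⟨e, he⟩ : G.edgeFinset.Nonempty := Finset.card_pos.1 (by omega)
        induction e with
        | _ u w =>
          refine ⟨u, w, by simpa using he, hS _, ?_⟩
          rw [Finset.filter_false_of_mem fun x _ => not_lt.2 (hS _)]
          simp
    obtain ⟨G', hG'⟩ : ∃ G', G' = G.deleteEdges {s(u, w)} := ⟨_, rfl⟩
    have hadj : ∀ x y, G'.Adj x y → G.Adj x y := fun x y h => by
      rw [hG'] at h
      exact SimpleGraph.deleteEdges_le _ h
    have hsub : ∀ x, G'.neighborFinset x ⊆ G.neighborFinset x := fun x y hy => by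
      simpa using hadj x y (by simpa using hy)
    obtain ⟨f, hf⟩ := ih G'
      (fun x => (Finset.card_le_card (Finset.filter_subset_filter _ (hsub x))).trans (hd x))
      (fun x => (Finset.card_le_card (hsub x)).trans (hdeg x)) (by
        have : G'.edgeFinset = G.edgeFinset.erase s(u, w) := by
          ext e
          simp [hG', and_comm]
        rw [this, Finset.card_erase_of_mem (by simpa using huw), hn]
        rfl)
    exact exists_isProperOn_of_deleteEdge hk hdeg huw hw hu (hG' ▸ hf)

end Vizing

/-! ### Counting indices -/

section CountIndices

variable {m : ℕ} {p q r : Fin m → Prop}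

open scoped Classical in
/-- The number of indices with the property `p`. -/
noncomputable def countIndices (p : Fin m → Prop) : ℕ :=
  (Finset.univ.filter p).card

theorem countIndices_le_card {β : Type*} (f : Fin m → β) (T : Finset β) (hT : ∀ i, p i → f i ∈ T)
    (hf : ∀ i j, p i → p j → f i = f j → i = j) : countIndices p ≤ T.card := by
  refine Finset.card_le_card_of_injOn f (fun i hi => hT i (by simpa using hi)) ?_
  intro i hi j hj h
  exact hf i j (by simpa using hi) (by simpa using hj) h

theorem card_le_countIndices {β : Type*} (f : β → Fin m) (T : Finset β) (hT : ∀ x ∈ T, p (f x))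
    (hf : ∀ x ∈ T, ∀ y ∈ T, f x = f y → x = y) : T.card ≤ countIndices p := by
  refine Finset.card_le_card_of_injOn f (fun x hx => ?_) fun x hx y hy => hf x hx y hy
  simpa using hT x hx

theorem countIndices_le_countIndices {m' : ℕ} {q : Fin m' → Prop} (f : Fin m → Fin m')
    (h : ∀ i, p i → q (f i)) (hf : ∀ i j, p i → p j → f i = f j → i = j) :
    countIndices p ≤ countIndices q :=
  card_le_countIndices f _ (fun i hi => h i (by simpa using hi)) fun i hi j hj =>
    hf i j (by simpa using hi) (by simpa using hj)

theorem countIndices_eq_zero (h : ∀ i, ¬ p i) : countIndices p = 0 := by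
  simp [countIndices, h]

open scoped Classical in
theorem countIndices_mono (h : ∀ i, p i → q i) : countIndices p ≤ countIndices q :=
  Finset.card_le_card (Finset.monotone_filter_right _ fun i _ => h i)

open scoped Classical in
theorem countIndices_lt (h : ∀ i, p i → q i) {i : Fin m} (hq : q i) (hp : ¬ p i) :
    countIndices p < countIndices q :=
  Finset.card_lt_card (Finset.ssubset_iff_of_subset
    (Finset.monotone_filter_right _ fun i _ => h i) |>.2 ⟨i, by simpa using hq, by simpa using hp⟩)

open scoped Classical in
theorem countIndices_or_le :
    countIndices (fun i => p i ∨ q i) ≤ countIndices p + countIndices q := by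
  refine (Finset.card_le_card ?_).trans (Finset.card_union_le _ _)
  intro i hi
  simpa using hi

open scoped Classical in
theorem countIndices_or (h : ∀ i, p i → ¬ q i) :
    countIndices (fun i => p i ∨ q i) = countIndices p + countIndices q := by
  simp only [countIndices]
  rw [← Finset.card_union_of_disjoint (Finset.disjoint_filter.2 fun i _ => h i)]
  congr 1
  ext i
  simp

theorem countIndices_or_and_le :
    countIndices (fun i => (p i ∨ q i) ∧ r i) ≤
      countIndices (fun i => p i ∧ r i) + countIndices (fun i => q i ∧ r i) :=
  (countIndices_mono fun i h => by tauto).trans countIndices_or_le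

theorem countIndices_and_add_not :
    countIndices (fun i => p i ∧ q i) + countIndices (fun i => p i ∧ ¬ q i) =
      countIndices p := by
  rw [← countIndices_or fun i h h' => h'.2 h.2]
  congr 1
  ext i
  tauto

theorem sum_countIndices (g : Fin m → ℕ) (t : ℕ) :
    ∑ s ∈ Finset.range t, countIndices (fun i => p i ∧ g i = s) =
      countIndices fun i => p i ∧ g i < t := by
  induction t with
  | zero => simp [countIndices]
  | succ t ih =>
    rw [Finset.sum_range_succ, ih, ← countIndices_or fun i h h' => h.2.ne h'.2]
    congr 1
    ext i
    rw [Nat.lt_succ_iff_lt_or_eq]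
    tauto

end CountIndices

/-! ### The chromatic index of an input -/

section ChromaticIndex

variable {V : Type u} {m : ℕ} {σ : Fin m → Sym2 V}

theorem IsInput.mem_edgeSet (hσ : IsInput σ) (e : Sym2 V) :
    e ∈ (inputGraph σ).edgeSet ↔ ∃ i, σ i = e := by
  rw [inputGraph, SimpleGraph.edgeSet_fromEdgeSet]
  constructor
  · rintro ⟨⟨i, hi⟩, -⟩
    exact ⟨i, hi⟩
  · rintro ⟨i, rfl⟩
    exact ⟨⟨i, rfl⟩, hσ.2 i⟩

theorem IsInput.edgeColorable_iff (hσ : IsInput σ) (k : ℕ) :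
    EdgeColorable (inputGraph σ) k ↔ ∃ c : Fin m → ℕ, (∀ i, c i < k) ∧
      ∀ i j, i ≠ j → (∃ x, x ∈ σ i ∧ x ∈ σ j) → c i ≠ c j := by
  constructor
  · rintro ⟨c, hc⟩
    refine ⟨fun i => c ⟨σ i, (hσ.mem_edgeSet _).2 ⟨i, rfl⟩⟩, fun i => (c _).2, ?_⟩
    intro i j hij hx h
    refine hc _ _ (fun h' => hij (hσ.1 ?_)) hx (Fin.ext h)
    simpa using h'
  · rintro ⟨c, hck, hc⟩
    have hidx : ∀ e : (inputGraph σ).edgeSet, ∃ i, σ i = e := fun e => (hσ.mem_edgeSet _).1 e.2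
    choose idx hidx using hidx
    refine ⟨fun e => ⟨c (idx e), hck _⟩, ?_⟩
    rintro e f hef ⟨x, hxe, hxf⟩ h
    refine hc (idx e) (idx f) (fun h' => hef ?_) ⟨x, ?_, ?_⟩ (by simpa using h)
    · rw [Subtype.ext_iff, ← hidx e, ← hidx f, h']
    · rwa [hidx]
    · rwa [hidx]

theorem IsInput.edgeColorable_chromaticIndex (hσ : IsInput σ) :
    EdgeColorable (inputGraph σ) (chromaticIndex (inputGraph σ)) :=
  Nat.sInf_mem (s := {k | EdgeColorable (inputGraph σ) k}) ⟨m, (hσ.edgeColorable_iff m).2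
    ⟨fun i => i, fun i => i.2, fun _ _ hij _ h => hij (Fin.ext h)⟩⟩

/-- A proper edge colouring with colours in `{1, …, χ'}` uses all of them. -/
theorem IsInput.isOptimalColoring (hσ : IsInput σ) {c : Fin m → ℕ}
    (hc : ∀ i j, i ≠ j → (∃ x, x ∈ σ i ∧ x ∈ σ j) → c i ≠ c j)
    (h1 : ∀ i, 1 ≤ c i) (h2 : ∀ i, c i ≤ chromaticIndex (inputGraph σ)) :
    IsOptimalColoring σ c := by
  refine ⟨hc, ?_⟩
  set T := Finset.univ.image c with hT
  have hsub : T ⊆ Finset.Icc 1 (chromaticIndex (inputGraph σ)) := by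
    intro a ha
    simp only [hT, Finset.mem_image, Finset.mem_univ, true_and] at ha
    obtain ⟨i, rfl⟩ := ha
    exact Finset.mem_Icc.2 ⟨h1 i, h2 i⟩
  have hmem : ∀ i, c i ∈ T := fun i => Finset.mem_image_of_mem _ (Finset.mem_univ i)
  have hcard : chromaticIndex (inputGraph σ) ≤ T.card := by
    refine Nat.sInf_le ((hσ.edgeColorable_iff _).2
      ⟨fun i => T.equivFin ⟨c i, hmem i⟩, fun i => (T.equivFin _).2, fun i j hij hx h => ?_⟩)
    have := T.equivFin.injective (Fin.ext h)
    exact hc i j hij hx (by simpa using this)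
  have heq := Finset.eq_of_subset_of_card_le hsub (by simpa using hcard)
  ext a
  rw [← Finset.coe_Icc, ← heq, hT]
  simp

theorem IsInput.countIndices_le_chromaticIndex (hσ : IsInput σ) (x : V) :
    countIndices (fun i => x ∈ σ i) ≤ chromaticIndex (inputGraph σ) := by
  obtain ⟨c, hck, hc⟩ := (hσ.edgeColorable_iff _).1 hσ.edgeColorable_chromaticIndex
  refine (countIndices_le_card c (Finset.range (chromaticIndex (inputGraph σ)))
    (fun i _ => by simpa using hck i) ?_).trans (by simp)
  intro i j hi hj h
  by_contra hij
  exact hc i j hij ⟨x, hi, hj⟩ h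

end ChromaticIndex

/-! ### Filling groups with reserved places -/

section Slots

/-- The number of free places in the first `t` groups of size `c`, if `b s` places of group `s` are
reserved. -/
def slotStart (c : ℕ) (b : ℕ → ℕ) (t : ℕ) : ℕ :=
  ∑ s ∈ Finset.range t, (c - b s)

/-- The group of the `j`-th free place. -/
noncomputable def slot (c : ℕ) (b : ℕ → ℕ) (j : ℕ) : ℕ :=
  sInf {t | j < slotStart c b (t + 1)}

variable {c B : ℕ} {b : ℕ → ℕ}

theorem slotStart_mono : Monotone (slotStart c b) := fun _ _ h =>
  Finset.sum_le_sum_of_subset (Finset.range_mono h)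

theorem slotStart_le (t : ℕ) : slotStart c b t ≤ c * t := by
  rw [slotStart]
  refine (Finset.sum_le_sum fun s _ => Nat.sub_le c (b s)).trans ?_
  simp [mul_comm]

theorem mul_le_slotStart_add (t : ℕ) :
    c * t ≤ slotStart c b t + ∑ s ∈ Finset.range t, b s := by
  rw [slotStart, ← Finset.sum_add_distrib]
  calc c * t = ∑ _s ∈ Finset.range t, c := by simp [mul_comm]
    _ ≤ _ := Finset.sum_le_sum fun s _ => by omega

section

variable (hc : 0 < c) (hB : ∀ t, ∑ s ∈ Finset.range t, b s ≤ B)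
include hc hB

theorem lt_slotStart_slot_succ (j : ℕ) : j < slotStart c b (slot c b j + 1) := by
  -- The groups up to `j + B` have at least `j + B + 1` places, at most `B` of them reserved.
  refine Nat.sInf_mem (s := {t | j < slotStart c b (t + 1)}) ⟨j + B, ?_⟩
  have h1 := mul_le_slotStart_add (c := c) (b := b) (j + B + 1)
  have h2 := hB (j + B + 1)
  have h3 : j + B + 1 ≤ c * (j + B + 1) := Nat.le_mul_of_pos_left _ hc
  simp only [Set.mem_ofPred_eq]
  omega

omit hc hB in
theorem slotStart_slot_le (j : ℕ) : slotStart c b (slot c b j) ≤ j := by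
  rcases h : slot c b j with _ | t
  · simp [slotStart]
  · by_contra! hlt
    have : slot c b j ≤ t := Nat.sInf_le hlt
    omega

theorem le_slot_iff (j t : ℕ) : t ≤ slot c b j ↔ slotStart c b t ≤ j := by
  constructor
  · exact fun h => (slotStart_mono h).trans (slotStart_slot_le j)
  · intro h
    by_contra! hlt
    have := lt_slotStart_slot_succ hc hB j
    have := slotStart_mono (c := c) (b := b) (Nat.succ_le_of_lt hlt)
    simp only [Nat.succ_eq_add_one] at this
    omega

theorem slot_mono : Monotone (slot c b) := fun i j hij => by
  rw [le_slot_iff hc hB]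
  exact (slotStart_slot_le i).trans hij

theorem div_le_slot (j : ℕ) : j / c ≤ slot c b j := by
  rw [le_slot_iff hc hB]
  exact (slotStart_le _).trans (Nat.mul_div_le j c)

omit hc in
theorem mul_slot_le (j : ℕ) : c * slot c b j ≤ j + B :=
  (mul_le_slotStart_add _).trans (add_le_add (slotStart_slot_le j) (hB _))

theorem slot_le_div_add_one (hBc : B ≤ c) (j : ℕ) : slot c b j ≤ j / c + 1 := by
  have h := mul_slot_le (c := c) hB j
  have h1 : j < c * (j / c) + c := by
    have := Nat.div_add_mod j c
    have := Nat.mod_lt j hc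
    omega
  by_contra! hlt
  have h2 : c * (j / c + 2) ≤ c * slot c b j := Nat.mul_le_mul_left c hlt
  have h3 : c * (j / c + 2) = c * (j / c) + c + c := by ring
  omega

end

end Slots

/-! ### Positions among edges with the same tail -/

section Positions

variable {m : ℕ} {α : Type*}

/-- The number of members of a sequence before position `i` that are equal to the one at `i`. -/
noncomputable def position (a : Fin m → α) (i : Fin m) : ℕ :=
  countIndices fun j => j < i ∧ a j = a i

theorem position_comp {β : Type*} {f : α → β} (hf : Function.Injective f) (a : Fin m → α)
    (i : Fin m) : position (fun j => f (a j)) i = position a i := by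
  simp only [position, hf.eq_iff]

theorem position_lt_position {a : Fin m → α} {i j : Fin m} (h : a i = a j) (hij : i < j) :
    position a i < position a j :=
  countIndices_lt (fun _ hk => ⟨hk.1.trans hij, hk.2.trans h⟩) (i := i) ⟨hij, h⟩
    fun h' => lt_irrefl i h'.1

theorem position_mono {a : Fin m → α} {i j : Fin m} (h : a i = a j) (hij : i ≤ j) :
    position a i ≤ position a j := by
  rcases hij.eq_or_lt with rfl | hij
  · rfl
  · exact (position_lt_position h hij).le

theorem position_injOn {a : Fin m → α} {i j : Fin m} (h : a i = a j)
    (hp : position a i = position a j) : i = j := by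
  rcases lt_trichotomy i j with hij | hij | hij
  · exact absurd hp (position_lt_position h hij).ne
  · exact hij
  · exact absurd hp (position_lt_position h.symm hij).ne'

theorem position_lt_countIndices (a : Fin m → α) (i : Fin m) :
    position a i < countIndices fun j => a j = a i :=
  countIndices_lt (fun _ hk => hk.2) (i := i) rfl fun h' => lt_irrefl i h'.1

open scoped Classical in
/-- The positions of equal members are consecutive. -/
theorem exists_position_eq (a : Fin m → α) (i : Fin m) {p : ℕ} (hp : p < position a i) :
    ∃ j < i, a j = a i ∧ position a j = p := by
  set T := Finset.univ.filter fun j => j < i ∧ a j = a i with hT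
  have hmem : ∀ j, j ∈ T ↔ j < i ∧ a j = a i := fun j => by simp [hT]
  -- `position a` is injective on `T`, and `T` has `position a i` elements by definition, so no
  -- value is skipped.
  have himg : T.image (position a) = Finset.range (position a i) := by
    refine Finset.eq_of_subset_of_card_le ?_ ?_
    · intro q hq
      simp only [Finset.mem_image, hmem] at hq
      obtain ⟨j, ⟨hj, hja⟩, rfl⟩ := hq
      exact Finset.mem_range.2 (position_lt_position hja hj)
    · rw [Finset.card_image_of_injOn]
      · rw [Finset.card_range, hT, position, countIndices]
        exact le_of_eq (by congr)
      · intro j hj k hk h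
        exact position_injOn (((hmem j).1 hj).2.trans ((hmem k).1 hk).2.symm) h
  have := Finset.mem_range.2 hp
  rw [← himg, Finset.mem_image] at this
  obtain ⟨j, hj, rfl⟩ := this
  exact ⟨j, ((hmem j).1 hj).1, ((hmem j).1 hj).2, rfl⟩

end Positions

/-! ### Distribution of the edges to groups -/

section Groups

variable {m n : ℕ} {lo hi : Fin m → Fin n} {g : Fin m → ℕ} {c d : ℕ}

/-- The number of edges of group `t` whose larger endpoint is `u`. -/
noncomputable def reserved (hi : Fin m → Fin n) (g : Fin m → ℕ) (u : Fin n) (t : ℕ) : ℕ :=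
  countIndices (fun k => hi k = u ∧ g k = t)

/-- Every vertex distributes the edges to larger vertices, in order of arrival, to groups of size
`c`, leaving the room that the edges to smaller vertices need. -/
theorem exists_groups (c : ℕ) (hlt : ∀ i, lo i < hi i) :
    ∃ g : Fin m → ℕ, ∀ i, g i = slot c (reserved hi g (lo i)) (position lo i) := by
  have hwf : WellFounded (fun k i : Fin m => lo k < lo i) := (measure fun i => (lo i : ℕ)).wf
  -- The places reserved at `lo i` depend only on edges `k` with `hi k = lo i`, whose tails are
  -- smaller; the recursion runs along the vertex order, not along arrival.
  let F : (i : Fin m) → ((k : Fin m) → lo k < lo i → ℕ) → ℕ := fun i rec =>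
    slot c (fun t => (countIndices fun k => ∃ h : hi k = lo i,
      rec k (h ▸ hlt k) = t)) (position lo i)
  refine ⟨hwf.fix F, fun i => ?_⟩
  rw [hwf.fix_eq]
  change slot c (fun t => countIndices fun k => ∃ _ : hi k = lo i, hwf.fix F k = t) _ = _
  congr 1
  ext t
  simp only [reserved, exists_prop]

theorem sum_reserved_le (u : Fin n) (t : ℕ) :
    ∑ s ∈ Finset.range t, reserved hi g u s ≤ countIndices (fun k => hi k = u) := by
  simp only [reserved, sum_countIndices]
  exact countIndices_mono fun _ h => h.1

theorem reserved_le (u : Fin n) (t : ℕ) :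
    reserved hi g u t ≤ countIndices (fun k => hi k = u) :=
  countIndices_mono fun _ h => h.1

variable (hg : ∀ i, g i = slot c (reserved hi g (lo i)) (position lo i)) (hc : 0 < c)
include hg hc

theorem group_mono {i j : Fin m} (h : lo i = lo j) (hij : i ≤ j) : g i ≤ g j := by
  rw [hg i, hg j, h]
  exact slot_mono hc (sum_reserved_le _) (position_mono h hij)

theorem div_le_group (i : Fin m) : position lo i / c ≤ g i := by
  rw [hg i]
  exact div_le_slot hc (sum_reserved_le _) _

theorem group_le_div_add_one (hd : ∀ u, countIndices (fun k => hi k = u) ≤ d)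
    (hdc : d ≤ c) (i : Fin m) : g i ≤ position lo i / c + 1 := by
  rw [hg i]
  exact slot_le_div_add_one hc (sum_reserved_le _) ((hd _).trans hdc) _

omit hc in
theorem mul_group_lt (hlt : ∀ i, lo i < hi i) (i : Fin m) :
    c * g i < countIndices (fun j => lo j = lo i ∨ hi j = lo i) := by
  have h1 := mul_slot_le (c := c) (sum_reserved_le (hi := hi) (g := g) (lo i)) (position lo i)
  rw [← hg i] at h1
  have h2 := position_lt_countIndices lo i
  rw [countIndices_or fun j h h' => (hlt j).ne (h.trans h'.symm)]
  omega

/-- Edges with tail `u` occupy only the free places of the group, and the remaining places are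
exactly those reserved for edges with larger endpoint `u`. -/
theorem card_group_le (hd : ∀ u, countIndices (fun k => hi k = u) ≤ d) (hdc : d ≤ c)
    (u : Fin n) (t : ℕ) :
    countIndices (fun i => (lo i = u ∨ hi i = u) ∧ g i = t) ≤ c := by
  have h1 : countIndices (fun i => lo i = u ∧ g i = t) ≤
      c - reserved hi g u t := by
    have : (Finset.Ico (slotStart c (reserved hi g u) t)
        (slotStart c (reserved hi g u) (t + 1))).card = c - reserved hi g u t := by
      rw [Nat.card_Ico, slotStart, slotStart, Finset.sum_range_succ]
      omega
    rw [← this]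
    refine countIndices_le_card (position lo) _ ?_ ?_
    · rintro i ⟨rfl, rfl⟩
      rw [Finset.mem_Ico]
      have h1 := slotStart_slot_le (c := c) (b := reserved hi g (lo i)) (position lo i)
      have h2 := lt_slotStart_slot_succ hc (sum_reserved_le (hi := hi) (g := g) (lo i))
        (position lo i)
      rw [← hg i] at h1 h2
      exact ⟨h1, h2⟩
    · rintro i j ⟨h1, -⟩ ⟨h2, -⟩ h
      exact position_injOn (h1.trans h2.symm) h
  have h2 := countIndices_or_and_le (p := fun i => lo i = u) (q := fun i => hi i = u)
    (r := fun i => g i = t)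
  have h3 := (reserved_le (hi := hi) (g := g) u t).trans ((hd u).trans hdc)
  simp only [reserved] at h1 h3
  omega

/-- If some edge with tail `u` overflows, the first `Q` groups are full at `u` and hold at least `c
* Q` of its edges. Otherwise only edges with larger endpoint `u` overflow, at most `d ≤ h` in
number. -/
theorem card_overflow_le (hlt : ∀ i, lo i < hi i)
    (hd : ∀ u, countIndices (fun k => hi k = u) ≤ d) {Q h : ℕ} (hdh : d ≤ h)
    (u : Fin n) (hu : countIndices (fun i => lo i = u ∨ hi i = u) ≤ c * Q + h) :
    countIndices (fun i => (lo i = u ∨ hi i = u) ∧ Q ≤ g i) ≤ h := by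
  have hsplit := countIndices_or_and_le (p := fun i => lo i = u) (q := fun i => hi i = u)
    (r := fun i => Q ≤ g i)
  have hback : countIndices (fun i => hi i = u ∧ Q ≤ g i) +
      ∑ s ∈ Finset.range Q, reserved hi g u s =
        countIndices (fun i => hi i = u) := by
    simp only [reserved, sum_countIndices, ← not_lt]
    rw [add_comm, countIndices_and_add_not]
  by_cases hex : ∃ i, lo i = u ∧ Q ≤ g i
  · have hfwd : countIndices (fun i => lo i = u ∧ Q ≤ g i) ≤
        countIndices (fun i => lo i = u) - slotStart c (reserved hi g u) Q := by
      rw [← Nat.card_Ico]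
      refine countIndices_le_card (position lo) _ ?_ ?_
      · rintro i ⟨rfl, hQ⟩
        rw [Finset.mem_Ico]
        rw [hg i, le_slot_iff hc (sum_reserved_le _)] at hQ
        exact ⟨hQ, position_lt_countIndices lo i⟩
      · rintro i j ⟨h1, -⟩ ⟨h2, -⟩ h
        exact position_injOn (h1.trans h2.symm) h
    have hpos : slotStart c (reserved hi g u) Q <
        countIndices (fun i => lo i = u) := by
      obtain ⟨i, rfl, hQ⟩ := hex
      rw [hg i, le_slot_iff hc (sum_reserved_le _)] at hQ
      exact hQ.trans_lt (position_lt_countIndices lo i)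
    have hmul := mul_le_slotStart_add (c := c) (b := reserved hi g u) Q
    rw [countIndices_or fun j h h' => (hlt j).ne (h.trans h'.symm)] at hu
    omega
  · have h0 : countIndices (fun i => lo i = u ∧ Q ≤ g i) = 0 :=
      countIndices_eq_zero fun i h => hex ⟨i, h⟩
    have := hd u
    omega

/-- Because `d < c`, every group has a free place at the tail, so groups below that of `i` have been
visited by earlier edges with the same tail. The decoder learns `Q` from this. -/
theorem exists_group_add_one_eq (hd : ∀ u, countIndices (fun k => hi k = u) ≤ d)
    (hdc : d < c) {Q : ℕ} (hQ : 0 < Q) {i : Fin m} (hi' : Q ≤ g i) : ∃ j < i, g j + 1 = Q := by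
  obtain ⟨t, rfl⟩ := Nat.exists_eq_add_of_le' hQ
  rw [hg i, le_slot_iff hc (sum_reserved_le _)] at hi'
  have hstep : slotStart c (reserved hi g (lo i)) t <
      slotStart c (reserved hi g (lo i)) (t + 1) := by
    have := ((reserved_le (hi := hi) (g := g) (lo i) t).trans (hd _)).trans_lt hdc
    rw [slotStart, slotStart, Finset.sum_range_succ]
    omega
  obtain ⟨j, hj, hja, hjp⟩ := exists_position_eq lo i (hstep.trans_le hi')
  refine ⟨j, hj, ?_⟩
  have h1 : t ≤ g j := by
    rw [hg j, le_slot_iff hc (sum_reserved_le _), hjp, hja]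
  have h2 : ¬ t + 1 ≤ g j := by
    rw [hg j, le_slot_iff hc (sum_reserved_le _), hjp, hja]
    exact not_le.2 hstep
  omega

end Groups

/-! ### Colouring a subset of the input -/

section IndexedVizing

variable {m n : ℕ} {lo hi : Fin m → Fin n}

/-- `exists_isProperOn` for a set of edges given by an enumeration of their endpoints. -/
theorem exists_coloring_of_card_le {d k : ℕ} (hk : 2 * d ≤ k) (hlt : ∀ i, lo i < hi i)
    (hinj : ∀ i j, lo i = lo j → hi i = hi j → i = j)
    (hd : ∀ u, countIndices (fun i => hi i = u) ≤ d) (A : Fin m → Prop)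
    (hdeg : ∀ u, countIndices (fun i => (lo i = u ∨ hi i = u) ∧ A i) ≤ k) :
    ∃ col : Fin m → ℕ, (∀ i, A i → col i < k) ∧ ∀ i j, A i → A j → i ≠ j →
      (∃ u, (lo i = u ∨ hi i = u) ∧ (lo j = u ∨ hi j = u)) → col i ≠ col j := by
  obtain ⟨G, hG⟩ : ∃ G : SimpleGraph (Fin n),
    G = SimpleGraph.fromEdgeSet {e | ∃ i, A i ∧ s(lo i, hi i) = e} := ⟨_, rfl⟩
  have hadj : ∀ x y, G.Adj x y ↔ ∃ i, A i ∧ s(lo i, hi i) = s(x, y) := by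
    intro x y
    rw [hG, SimpleGraph.fromEdgeSet_adj]
    constructor
    · exact fun h => h.1
    · rintro ⟨i, hi', he⟩
      refine ⟨⟨i, hi', he⟩, ?_⟩
      rintro rfl
      have := (hlt i).ne
      rcases Sym2.eq_iff.1 he with ⟨h1, h2⟩ | ⟨h1, h2⟩ <;> exact this (h1.trans h2.symm)
  rcases isEmpty_or_nonempty (Fin m) with hm | hm
  · exact ⟨fun _ => 0, fun i => hm.elim i, fun i => hm.elim i⟩
  have hidx : ∀ x y, ∃ i, G.Adj x y → A i ∧ s(lo i, hi i) = s(x, y) := by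
    intro x y
    by_cases h : G.Adj x y
    · obtain ⟨i, hi'⟩ := (hadj x y).1 h
      exact ⟨i, fun _ => hi'⟩
    · exact ⟨hm.some, fun h' => absurd h' h⟩
  choose idx hidx using hidx
  have hidx_inj : ∀ x y z, G.Adj x y → G.Adj x z → idx x y = idx x z → y = z := by
    intro x y z hy hz h
    have := (hidx x y hy).2
    rw [h, (hidx x z hz).2] at this
    exact (Sym2.congr_right.1 this).symm
  classical
  obtain ⟨f, hf⟩ := exists_isProperOn d k hk G
    (fun x => (card_le_countIndices (p := fun i => hi i = x) (idx x) _ (fun y hy => by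
      obtain ⟨hxy, hyx⟩ : G.Adj x y ∧ y < x := by simpa using hy
      have h1 := hlt (idx x y)
      rcases Sym2.eq_iff.1 (hidx x y hxy).2 with ⟨h, h'⟩ | ⟨h, h'⟩
      · rw [h, h'] at h1
        exact absurd h1 hyx.asymm
      · exact h') (fun y hy z hz => hidx_inj x y z (by simpa using (Finset.mem_filter.1 hy).1)
        (by simpa using (Finset.mem_filter.1 hz).1))).trans (hd x))
    (fun x => (card_le_countIndices (p := fun i => (lo i = x ∨ hi i = x) ∧ A i) (idx x)
      (G.neighborFinset x) (fun y hy => by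
      have hxy : G.Adj x y := by simpa using hy
      refine ⟨?_, (hidx x y hxy).1⟩
      rcases Sym2.eq_iff.1 (hidx x y hxy).2 with ⟨h, h'⟩ | ⟨h, h'⟩
      · exact Or.inl h
      · exact Or.inr h') (fun y hy z hz => hidx_inj x y z (by simpa using hy)
        (by simpa using hz))).trans (hdeg x))
  have hedge : ∀ i, A i → G.Adj (lo i) (hi i) := fun i h => (hadj _ _).2 ⟨i, h, rfl⟩
  have hend : ∀ i u, A i → lo i = u ∨ hi i = u → ∃ y, G.Adj u y ∧ s(lo i, hi i) = s(u, y) := by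
    rintro i u h (rfl | rfl)
    · exact ⟨_, hedge i h, rfl⟩
    · exact ⟨_, (hedge i h).symm, Sym2.eq_swap⟩
  refine ⟨fun i => f s(lo i, hi i), fun i h => hf.1 _ _ (hedge i h), ?_⟩
  rintro i j hi' hj hij ⟨u, hui, huj⟩ h
  obtain ⟨y, hy, hyi⟩ := hend i u hi' hui
  obtain ⟨z, hz, hzj⟩ := hend j u hj huj
  simp only [hyi, hzj] at h
  have he : s(lo i, hi i) = s(lo j, hi j) := by
    rw [hyi, hzj, hf.2 u y z hy hz h]
  rcases Sym2.eq_iff.1 he with ⟨h1, h2⟩ | ⟨h1, h2⟩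
  · exact hij (hinj i j h1 h2)
  · have := hlt i
    rw [h1, h2] at this
    exact this.asymm (hlt j)

end IndexedVizing

/-! ### Optimal colourings built from groups -/

section Schemes

variable {V : Type u} {m : ℕ}

/-- An optimal edge colouring that arises from a division of the edges into groups: the groups
`0, …, Q - 1` receive `c` colours each, all other edges share the remaining colours. -/
structure Scheme (c : ℕ) (σ : Fin m → Sym2 V) where
  /-- The number of groups with `c` colours. -/
  Q : ℕ
  /-- The endpoint that determines the group. -/
  tail : Fin m → V
  /-- The group of an edge. -/
  g : Fin m → ℕ
  /-- The number of the colour within the group. -/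
  col : Fin m → ℕ
  tail_mem : ∀ i, tail i ∈ σ i
  mono : ∀ i j, tail i = tail j → i ≤ j → g i ≤ g j
  div_le : ∀ i, g i < Q → position tail i / c ≤ g i
  le_div : ∀ i, g i < Q → g i ≤ position tail i / c + 1
  col_lt : ∀ i, g i < Q → col i < c
  col_lt_two_mul : ∀ i, col i < 2 * c
  exists_eq : ∀ i, Q ≤ g i → 0 < Q → ∃ j < i, g j + 1 = Q
  isOptimal : IsOptimalColoring σ fun i => c * min (g i) Q + col i + 1

/-- The colour of an edge. -/
def Scheme.color {c : ℕ} {σ : Fin m → Sym2 V} (S : Scheme c σ) (i : Fin m) : ℕ :=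
  c * min (S.g i) S.Q + S.col i + 1

/-- The vertices of a degenerate graph may be numbered such that every vertex is the larger endpoint
of at most `d` edges. -/
theorem IsDegenerate.exists_ends {σ : Fin m → Sym2 V} {d : ℕ} (hσ : IsInput σ)
    (h : IsDegenerate (inputGraph σ) d) :
    ∃ (n : ℕ) (v : Fin n → V) (lo hi : Fin m → Fin n), Function.Injective v ∧
      (∀ i, lo i < hi i) ∧ (∀ i, σ i = s(v (lo i), v (hi i))) ∧
      ∀ u, countIndices (fun i => hi i = u) ≤ d := by
  obtain ⟨n, v, hv, hcov, hback⟩ := h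
  have hends : ∀ i, ∃ a b : Fin n, a < b ∧ σ i = s(v a, v b) := by
    intro i
    have hmem := (hσ.mem_edgeSet (σ i)).2 ⟨i, rfl⟩
    generalize σ i = e at hmem ⊢
    induction e with
    | _ x y =>
      have hxy : (inputGraph σ).Adj x y := hmem
      obtain ⟨a, rfl⟩ := hcov x ⟨y, hxy⟩
      obtain ⟨b, rfl⟩ := hcov y ⟨_, hxy.symm⟩
      rcases lt_trichotomy a b with hab | rfl | hab
      · exact ⟨a, b, hab, rfl⟩
      · exact absurd rfl hxy.ne
      · exact ⟨b, a, hab, Sym2.eq_swap⟩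
  choose lo hi hlt he using hends
  refine ⟨n, v, lo, hi, hv, hlt, he, fun u => ?_⟩
  refine le_trans ?_ (hback u)
  rw [Set.ncard_eq_toFinset_card _ (Set.toFinite _)]
  refine countIndices_le_card lo _ ?_ ?_
  · rintro i rfl
    rw [Set.Finite.mem_toFinset]
    refine ⟨hlt i, ?_⟩
    have hmem := (hσ.mem_edgeSet (σ i)).2 ⟨i, rfl⟩
    rw [he i] at hmem
    exact SimpleGraph.Adj.symm hmem
  · rintro i j rfl hj h
    exact hσ.1 (by rw [he i, he j, h, hj])

/-- A division into groups and proper colourings of the groups form a scheme. -/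
theorem nonempty_scheme_of_colorings {σ : Fin m → Sym2 V} (hσ : IsInput σ) {n : ℕ} {v : Fin n → V}
    {lo hi : Fin m → Fin n} (hv : Function.Injective v)
    (he : ∀ i, σ i = s(v (lo i), v (hi i))) {c d Q h : ℕ} (hc : 0 < c) (hdc : d ≤ c)
    (hd : ∀ u, countIndices (fun i => hi i = u) ≤ d) {g : Fin m → ℕ}
    (hg : ∀ i, g i = slot c (reserved hi g (lo i)) (position lo i))
    (hχ : chromaticIndex (inputGraph σ) = c * Q + h) (hh : h ≤ 2 * c)
    (hprev : ∀ i, Q ≤ g i → 0 < Q → ∃ j < i, g j + 1 = Q)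
    (hgroup : ∀ t, ∃ col : Fin m → ℕ, (∀ i, g i = t → col i < c) ∧
      ∀ i j, g i = t → g j = t → i ≠ j →
        (∃ u, (lo i = u ∨ hi i = u) ∧ (lo j = u ∨ hi j = u)) → col i ≠ col j)
    (hover : ∃ col : Fin m → ℕ, (∀ i, Q ≤ g i → col i < h) ∧
      ∀ i j, Q ≤ g i → Q ≤ g j → i ≠ j →
        (∃ u, (lo i = u ∨ hi i = u) ∧ (lo j = u ∨ hi j = u)) → col i ≠ col j) :
    Nonempty (Scheme c σ) := by
  choose gcol hgcol hgcol' using hgroup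
  obtain ⟨ocol, hocol, hocol'⟩ := hover
  set col : Fin m → ℕ := fun i => if g i < Q then gcol (g i) i else ocol i with hcol
  have hcol1 : ∀ i, g i < Q → col i = gcol (g i) i := fun i hi' => if_pos hi'
  have hcol2 : ∀ i, Q ≤ g i → col i = ocol i := fun i hi' => if_neg (not_lt.2 hi')
  have hlt1 : ∀ i, g i < Q → col i < c := fun i hi' => by
    rw [hcol1 i hi']
    exact hgcol _ i rfl
  have hlt2 : ∀ i, Q ≤ g i → col i < h := fun i hi' => by
    rw [hcol2 i hi']
    exact hocol i hi'
  have hshare : ∀ i j, (∃ x, x ∈ σ i ∧ x ∈ σ j) →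
      ∃ u, (lo i = u ∨ hi i = u) ∧ (lo j = u ∨ hi j = u) := by
    rintro i j ⟨x, hxi, hxj⟩
    rw [he i, Sym2.mem_iff] at hxi
    rw [he j, Sym2.mem_iff] at hxj
    rcases hxi with rfl | rfl
    · exact ⟨lo i, Or.inl rfl, by simpa [hv.eq_iff, eq_comm] using hxj⟩
    · exact ⟨hi i, Or.inr rfl, by simpa [hv.eq_iff, eq_comm] using hxj⟩
  -- Different groups below `Q`, and the overflow, use disjoint intervals of colours.
  have hsep : ∀ i j, g i < Q → g i < g j → c * min (g i) Q + col i < c * min (g j) Q := by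
    intro i j hi' hij
    have h1 := hlt1 i hi'
    rw [min_eq_left hi'.le]
    have h2 : c * (g i + 1) ≤ c * min (g j) Q := Nat.mul_le_mul_left c (le_min hij hi')
    rw [mul_add, mul_one] at h2
    omega
  exact ⟨{
    Q := Q
    tail := fun i => v (lo i)
    g := g
    col := col
    tail_mem := fun i => by simp [he i]
    mono := fun i j hij => group_mono hg hc (hv hij)
    div_le := fun i _ => by
      rw [position_comp hv]
      exact div_le_group hg hc i
    le_div := fun i _ => by
      rw [position_comp hv]
      exact group_le_div_add_one hg hc hd hdc i
    col_lt := hlt1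
    col_lt_two_mul := fun i => by
      rcases lt_or_ge (g i) Q with hi' | hi'
      · have := hlt1 i hi'
        omega
      · exact (hlt2 i hi').trans_le hh
    exists_eq := hprev
    isOptimal := by
      refine hσ.isOptimalColoring ?_ (fun i => by omega) ?_
      · intro i j hij hx heq
        have hx := hshare i j hx
        rcases lt_or_ge (g i) Q with hi' | hi' <;> rcases lt_or_ge (g j) Q with hj' | hj'
        · rcases lt_trichotomy (g i) (g j) with hlt | hgg | hlt
          · have := hsep i j hi' hlt
            omega
          · refine hgcol' (g i) i j rfl hgg.symm hij hx ?_
            rw [hcol1 i hi', hcol1 j hj', hgg] at heq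
            rw [hgg]
            omega
          · have := hsep j i hj' hlt
            omega
        · have := hsep i j hi' (hi'.trans_le hj')
          omega
        · have := hsep j i hj' (hj'.trans_le hi')
          omega
        · refine hocol' i j hi' hj' hij hx ?_
          rw [hcol2 i hi', hcol2 j hj', min_eq_right hi', min_eq_right hj'] at heq
          omega
      · intro i
        rw [hχ]
        rcases lt_or_ge (g i) Q with hi' | hi'
        · have h1 := hlt1 i hi'
          have h2 : c * (g i + 1) ≤ c * Q := Nat.mul_le_mul_left c hi'
          rw [mul_add, mul_one] at h2
          rw [min_eq_left hi'.le]
          omega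
        · have h1 := hlt2 i hi'
          rw [min_eq_right hi']
          omega }⟩

/-- The number of colours per group. -/
def groupSize (d : ℕ) : ℕ :=
  if d = 1 then 1 else 2 * d

theorem nonempty_scheme {σ : Fin m → Sym2 V} {d : ℕ} (hd1 : 1 ≤ d) (hσ : IsInput σ)
    (hdeg : IsDegenerate (inputGraph σ) d) : Nonempty (Scheme (groupSize d) σ) := by
  obtain ⟨n, v, lo, hi, hv, hlt, he, hd⟩ := hdeg.exists_ends hσ
  have hχ : ∀ u, countIndices (fun i => lo i = u ∨ hi i = u) ≤
      chromaticIndex (inputGraph σ) := by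
    intro u
    refine le_trans (countIndices_mono fun i hi' => ?_) (hσ.countIndices_le_chromaticIndex (v u))
    rw [he i, Sym2.mem_iff]
    rcases hi' with rfl | rfl <;> simp
  have hinj : ∀ i j, lo i = lo j → hi i = hi j → i = j := fun i j h1 h2 =>
    hσ.1 (by rw [he i, he j, h1, h2])
  obtain ⟨g, hg⟩ := exists_groups (groupSize d) hlt
  by_cases hd1' : d = 1
  · subst hd1'
    have hone : groupSize 1 = 1 := rfl
    rw [hone] at hg ⊢
    have hlt' : ∀ i, g i < chromaticIndex (inputGraph σ) := fun i => by
      have := (mul_group_lt hg hlt i).trans_le (hχ _)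
      rwa [one_mul] at this
    -- For `d = 1` the group number of an edge is less than the degree of its tail, hence less than
    -- `χ'`: there is no overflow, and each group is a matching.
    refine nonempty_scheme_of_colorings hσ hv he one_pos le_rfl hd hg (h := 0)
      (Q := chromaticIndex (inputGraph σ)) (by simp) (by simp)
      (fun i hi' => absurd (hlt' i) (not_lt.2 hi')) (fun t => ⟨fun _ => 0, fun _ _ => one_pos, ?_⟩)
      ⟨fun _ => 0, fun i hi' => absurd (hlt' i) (not_lt.2 hi'),
        fun i _ hi' => absurd (hlt' i) (not_lt.2 hi')⟩
    rintro i j hi' hj hij ⟨u, hui, huj⟩ -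
    have := card_group_le hg one_pos hd le_rfl u t
    rw [countIndices, Finset.card_le_one] at this
    exact hij (this i (by simpa using ⟨hui, hi'⟩) j (by simpa using ⟨huj, hj⟩))
  have hsize : groupSize d = 2 * d := if_neg hd1'
  rw [hsize] at hg ⊢
  by_cases hsmall : chromaticIndex (inputGraph σ) < 2 * d
  · obtain ⟨c, hck, hc⟩ := (hσ.edgeColorable_iff _).1 hσ.edgeColorable_chromaticIndex
    -- With `Q = 0` every edge overflows, and `col` is an optimal colouring itself.
    exact ⟨{
      Q := 0
      tail := fun i => v (lo i)
      g := fun _ => 0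
      col := c
      tail_mem := fun i => by simp [he i]
      mono := fun _ _ _ _ => le_rfl
      div_le := fun i hi' => absurd hi' (lt_irrefl 0)
      le_div := fun i hi' => absurd hi' (lt_irrefl 0)
      col_lt := fun i hi' => absurd hi' (lt_irrefl 0)
      col_lt_two_mul := fun i => by
        have := hck i
        omega
      exists_eq := fun i _ hQ => absurd hQ (lt_irrefl 0)
      isOptimal := by
        refine hσ.isOptimalColoring ?_ (fun i => by omega) (fun i => ?_)
        · intro i j hij hx h
          exact hc i j hij hx (by omega)
        · have := hck i
          simp only [min_self, mul_zero]
          omega }⟩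
  · rw [not_lt] at hsmall
    have hpos : 0 < 2 * d := by omega
    -- One full group fewer than the quotient allows, so that the overflow keeps at least the `2 *
    -- d` colours that `exists_coloring_of_card_le` needs.
    obtain ⟨Q, hQ⟩ : ∃ Q, chromaticIndex (inputGraph σ) / (2 * d) = Q + 1 :=
      Nat.exists_eq_add_of_le' (Nat.div_pos hsmall hpos)
    have hsum : chromaticIndex (inputGraph σ) =
        2 * d * Q + (2 * d + chromaticIndex (inputGraph σ) % (2 * d)) := by
      have := Nat.div_add_mod (chromaticIndex (inputGraph σ)) (2 * d)
      rw [hQ, mul_add, mul_one] at this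
      omega
    have hmod := Nat.mod_lt (chromaticIndex (inputGraph σ)) hpos
    refine nonempty_scheme_of_colorings hσ hv he hpos (by omega) hd hg hsum (by omega)
      (fun i hi' hQ' => exists_group_add_one_eq hg hpos hd (by omega) hQ' hi') (fun t => ?_) ?_
    · exact exists_coloring_of_card_le le_rfl hlt hinj hd (fun i => g i = t) fun u =>
        card_group_le hg hpos hd (by omega) u t
    · exact exists_coloring_of_card_le (by omega) hlt hinj hd (fun i => Q ≤ g i) fun u =>
        card_overflow_le hg hpos hlt hd (by omega) u ((hχ u).trans hsum.le)

end Schemes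

/-! ### Encoding and online decoding -/

section Codes

variable {V : Type u} {m m' c : ℕ} {σ : Fin m → Sym2 V} {σ' : Fin m' → Sym2 V}

open scoped Classical in
/-- The information about an edge that the oracle provides. -/
noncomputable def Scheme.code (S : Scheme c σ) (i : Fin m) :
    (Bool × Bool × Fin c) ⊕ Fin (2 * c) :=
  if h : S.g i < S.Q then
    Sum.inl (decide ((Quot.out (σ i)).1 = S.tail i), decide (S.g i = position S.tail i / c),
      ⟨S.col i, S.col_lt i h⟩)
  else Sum.inr ⟨S.col i, S.col_lt_two_mul i⟩

theorem Scheme.of_code_eq {S : Scheme c σ} {S' : Scheme c σ'} {i : Fin m} {i' : Fin m'}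
    (h : S.code i = S'.code i') :
    (S.g i < S.Q ↔ S'.g i' < S'.Q) ∧ S.col i = S'.col i' ∧
      (S.g i < S.Q → ((Quot.out (σ i)).1 = S.tail i ↔ (Quot.out (σ' i')).1 = S'.tail i') ∧
        (S.g i = position S.tail i / c ↔ S'.g i' = position S'.tail i' / c)) := by
  unfold Scheme.code at h
  split_ifs at h with h1 h2 h2
  · simp only [Sum.inl.injEq, Prod.mk.injEq, decide_eq_decide, Fin.mk.injEq] at h
    exact ⟨by simp [h1, h2], h.2.2, fun _ => ⟨h.1, h.2.1⟩⟩
  · simp only [Sum.inr.injEq, Fin.mk.injEq] at h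
    exact ⟨by simp [h1, h2], h, fun h' => absurd h' h1⟩

/-- `Quot.out` picks an endpoint that depends on the edge alone, so one bit identifies the tail. -/
theorem eq_of_mem_of_out_eq_iff {e : Sym2 V} {x y : V} (hx : x ∈ e) (hy : y ∈ e)
    (h : (Quot.out e).1 = x ↔ (Quot.out e).1 = y) : x = y := by
  have he : s((Quot.out e).1, (Quot.out e).2) = e := Quot.out_eq e
  rw [← he, Sym2.mem_iff] at hx hy
  grind

theorem position_le_of_forall {α : Type*} {a : Fin m → α} {a' : Fin m' → α} {i : ℕ} (hi : i < m)
    (hi' : i < m') (h : ∀ j (hj : j < i), a ⟨j, hj.trans hi⟩ = a ⟨i, hi⟩ →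
      a' ⟨j, hj.trans hi'⟩ = a' ⟨i, hi'⟩) : position a ⟨i, hi⟩ ≤ position a' ⟨i, hi'⟩ := by
  refine countIndices_le_countIndices
    (fun j : Fin m => (⟨min j i, (min_le_right _ _).trans_lt hi'⟩ : Fin m')) ?_ ?_
  · rintro j ⟨hj, hja⟩
    have hj : (j : ℕ) < i := hj
    simp only [min_eq_left hj.le]
    exact ⟨hj, h j hj hja⟩
  · rintro j k ⟨hj, -⟩ ⟨hk, -⟩ hjk
    have hj : (j : ℕ) < i := hj
    have hk : (k : ℕ) < i := hk
    simp only [min_eq_left hj.le, min_eq_left hk.le, Fin.mk.injEq] at hjk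
    exact Fin.ext hjk

section

variable {S : Scheme c σ} {S' : Scheme c σ'} {i : ℕ} (hi : i < m) (hi' : i < m')
  (hσ : ∀ j : Fin (i + 1), σ (Fin.castLE hi j) = σ' (Fin.castLE hi' j))
  (hcode : ∀ j : Fin (i + 1), S.code (Fin.castLE hi j) = S'.code (Fin.castLE hi' j))
include hσ hcode

/-- An initial segment of the input and of the codes determines the groups. -/
theorem Scheme.group_eq_of_code_eq (j : ℕ) (hj : j ≤ i)
    (hQ : S.g ⟨j, hj.trans_lt hi⟩ < S.Q) :
    S.tail ⟨j, hj.trans_lt hi⟩ = S'.tail ⟨j, hj.trans_lt hi'⟩ ∧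
      S.g ⟨j, hj.trans_lt hi⟩ = S'.g ⟨j, hj.trans_lt hi'⟩ := by
  induction j using Nat.strong_induction_on with
  | _ j ih =>
    have hc := fun k (hk : k ≤ i) => Scheme.of_code_eq (hcode ⟨k, Nat.lt_succ_of_le hk⟩)
    simp only [Fin.castLE_mk] at hc
    have hσj := hσ ⟨j, Nat.lt_succ_of_le hj⟩
    simp only [Fin.castLE_mk] at hσj
    obtain ⟨hQQ, -, hcj⟩ := hc j hj
    obtain ⟨hout, hpos⟩ := hcj hQ
    have hQ' := hQQ.1 hQ
    have htail : S.tail ⟨j, hj.trans_lt hi⟩ = S'.tail ⟨j, hj.trans_lt hi'⟩ := by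
      refine eq_of_mem_of_out_eq_iff (S.tail_mem _) ?_ (hout.trans ?_)
      · rw [hσj]
        exact S'.tail_mem _
      · rw [hσj]
    have hposition : position S.tail ⟨j, hj.trans_lt hi⟩ =
        position S'.tail ⟨j, hj.trans_lt hi'⟩ := by
      refine le_antisymm (position_le_of_forall _ _ fun k hk hkt => ?_)
        (position_le_of_forall _ _ fun k hk hkt => ?_)
      -- An earlier edge with this tail lies in no later group, hence below `Q`, so the induction
      -- hypothesis applies to it.
      · have := S.mono _ _ hkt (by simpa using hk.le)
        rw [← (ih k hk (hk.le.trans hj) (this.trans_lt hQ)).1, hkt, htail]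
      · have := S'.mono _ _ hkt (by simpa using hk.le)
        rw [(ih k hk (hk.le.trans hj) ((hc k (hk.le.trans hj)).1.2 (this.trans_lt hQ'))).1, hkt,
          htail]
    refine ⟨htail, ?_⟩
    have h1 := S.div_le _ hQ
    have h2 := S.le_div _ hQ
    have h3 := S'.div_le _ hQ'
    have h4 := S'.le_div _ hQ'
    rw [hposition] at h1 h2 hpos
    -- Both groups are the same quotient or its successor, and the second bit of the code decides
    -- which.
    by_cases hp : S.g ⟨j, hj.trans_lt hi⟩ = position S'.tail ⟨j, hj.trans_lt hi'⟩ / c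
    · rw [hp, hpos.1 hp]
    · have := fun h => hp (hpos.2 h)
      omega

/-- An earlier edge of group `S.Q - 1` has the same group in `S'`, and its code says that this group
is below `S'.Q`. -/
theorem Scheme.Q_le_of_code_eq (hQ : S.Q ≤ S.g ⟨i, hi⟩) : S.Q ≤ S'.Q := by
  rcases Nat.eq_zero_or_pos S.Q with h0 | hpos
  · omega
  · obtain ⟨j, hj, hjQ⟩ := S.exists_eq _ hQ hpos
    have hj : (j : ℕ) < i := hj
    have hlt : S.g j < S.Q := by omega
    have heq := (Scheme.group_eq_of_code_eq hi hi' hσ hcode j hj.le hlt).2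
    have hcj := Scheme.of_code_eq (hcode ⟨j, Nat.lt_succ_of_lt hj⟩)
    simp only [Fin.castLE_mk, Fin.eta] at hcj heq
    have := hcj.1.1 hlt
    omega

/-- An initial segment of the input and of the codes determines the colours. -/
theorem Scheme.color_eq_of_code_eq : S.color ⟨i, hi⟩ = S'.color ⟨i, hi'⟩ := by
  have hc := Scheme.of_code_eq (hcode (Fin.last i))
  change (S.g ⟨i, hi⟩ < S.Q ↔ S'.g ⟨i, hi'⟩ < S'.Q) ∧ S.col ⟨i, hi⟩ = S'.col ⟨i, hi'⟩ ∧ _ at hc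
  obtain ⟨hQQ, hcol, -⟩ := hc
  rw [Scheme.color, Scheme.color, hcol]
  by_cases hQ : S.g ⟨i, hi⟩ < S.Q
  · rw [min_eq_left hQ.le, min_eq_left (hQQ.1 hQ).le,
      (Scheme.group_eq_of_code_eq hi hi' hσ hcode i le_rfl hQ).2]
  · have hQ' : ¬ S'.g ⟨i, hi'⟩ < S'.Q := fun h => hQ (hQQ.2 h)
    rw [not_lt] at hQ hQ'
    rw [min_eq_right hQ, min_eq_right hQ',
      (Scheme.Q_le_of_code_eq hi hi' hσ hcode hQ).antisymm
        (Scheme.Q_le_of_code_eq hi' hi (fun j => (hσ j).symm) (fun j => (hcode j).symm) hQ')]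

end

end Codes

/-! ### From codes to an algorithm, and the number of bits -/

/-- If the members of the input and the advice strings up to an edge determine its target colour,
then some decision rule produces the target colours. -/
theorem exists_adviceAlgorithm {V : Type u} {b : ℕ}
    (valid : ∀ m, (Fin m → Sym2 V) → Prop)
    (oracle : (m : ℕ) → (Fin m → Sym2 V) → Fin m → Fin b → Bool)
    (target : (m : ℕ) → (Fin m → Sym2 V) → Fin m → ℕ)
    (h : ∀ (m m' : ℕ) (σ : Fin m → Sym2 V) (σ' : Fin m' → Sym2 V), valid m σ → valid m' σ' →
      ∀ (i : ℕ) (hi : i < m) (hi' : i < m'),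
        (∀ j : Fin (i + 1), σ (Fin.castLE hi j) = σ' (Fin.castLE hi' j)) →
        (∀ j : Fin (i + 1), oracle m σ (Fin.castLE hi j) = oracle m' σ' (Fin.castLE hi' j)) →
        target m σ ⟨i, hi⟩ = target m' σ' ⟨i, hi'⟩) :
    ∃ A : AdviceAlgorithm V b, ∀ m σ, valid m σ → A.color σ = target m σ := by
  -- The rule answers as for any valid input compatible with what has been seen; `h` makes the
  -- choice irrelevant. Without such an input the answer is `0`.
  let P : (i : ℕ) → (Fin (i + 1) → Sym2 V) → (Fin (i + 1) → (Fin b → Bool)) → ℕ → Prop :=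
    fun i pre adv a => ∃ (m : ℕ) (σ : Fin m → Sym2 V) (hi : i < m), valid m σ ∧
      (∀ j, σ (Fin.castLE hi j) = pre j) ∧ (∀ j, oracle m σ (Fin.castLE hi j) = adv j) ∧
      target m σ ⟨i, hi⟩ = a
  have hP : ∀ i pre adv, ∃ a, (∃ a, P i pre adv a) → P i pre adv a := fun i pre adv => by
    by_cases hx : ∃ a, P i pre adv a
    · exact ⟨hx.choose, fun _ => hx.choose_spec⟩
    · exact ⟨0, fun h' => absurd h' hx⟩
  choose rule hrule using hP
  refine ⟨⟨rule, oracle⟩, fun m σ hσ => funext fun i => ?_⟩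
  obtain ⟨m', σ', hi', hσ', hpre, hadv, ha⟩ := hrule i (fun j => σ (Fin.castLE i.isLt j))
    (fun j => oracle m σ (Fin.castLE i.isLt j))
    ⟨_, m, σ, i.isLt, hσ, fun _ => rfl, fun _ => rfl, rfl⟩
  exact ha.symm.trans (h m' m σ' σ hσ' hσ i hi' i.isLt hpre hadv)

theorem AdviceAlgorithm.length_advice {V : Type u} {b m : ℕ} (A : AdviceAlgorithm V b)
    (σ : Fin m → Sym2 V) : (A.advice σ).length = m * b := by
  simp [AdviceAlgorithm.advice, List.length_flatten, List.map_ofFn, Function.comp_def]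

theorem le_two_pow_ceil_logb {x : ℝ} (hx : 0 < x) : x ≤ 2 ^ ⌈Real.logb 2 x⌉₊ := by
  rw [← Real.rpow_natCast, ← Real.logb_le_iff_le_rpow one_lt_two hx]
  exact Nat.le_ceil _

/-- The bits allow at least `4 * d * (d + 1)` strings. For `d ≥ 2` this covers the `12 * d` codes;
for `d = 1` it is only `8`, which is why `groupSize 1` is `1`. -/
theorem six_mul_groupSize_le {d : ℕ} (hd : 1 ≤ d) : 6 * groupSize d ≤ 2 ^ adviceBits d := by
  have hd' : (1 : ℝ) ≤ d := by exact_mod_cast hd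
  have h1 := le_two_pow_ceil_logb (x := 2 * (d : ℝ)) (by positivity)
  have h2 := le_two_pow_ceil_logb (x := (d : ℝ) + 1) (by positivity)
  have h3 : (2 : ℝ) * (2 * d * (d + 1)) ≤ 2 ^ adviceBits d := by
    rw [adviceBits, pow_add, pow_add, pow_one, mul_assoc 2 (2 ^ _) (2 ^ _)]
    gcongr
  have h4 : 2 * (2 * d * (d + 1)) ≤ 2 ^ adviceBits d := by exact_mod_cast h3
  refine le_trans ?_ h4
  unfold groupSize
  split_ifs with h
  · subst h
    norm_num
  · have : 2 ≤ d := by omega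
    nlinarith

theorem adviceBits_le {d : ℕ} (hd : 2 ≤ d) : (adviceBits d : ℝ) ≤ 7 * Real.logb 2 d := by
  have hd' : (2 : ℝ) ≤ d := by exact_mod_cast hd
  have hL : 1 ≤ Real.logb 2 d := by
    rw [Real.le_logb_iff_rpow_le one_lt_two (by linarith)]
    simpa using hd'
  have h2d : Real.logb 2 (2 * (d : ℝ)) = 1 + Real.logb 2 d := by
    rw [Real.logb_mul two_ne_zero (by linarith), Real.logb_self_eq_one one_lt_two]
  have hle : Real.logb 2 ((d : ℝ) + 1) ≤ 1 + Real.logb 2 d := by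
    rw [← h2d]
    exact Real.logb_le_logb_of_le one_lt_two (by linarith) (by linarith)
  have h1 := Nat.ceil_lt_add_one (a := Real.logb 2 (2 * (d : ℝ))) (by rw [h2d]; linarith)
  have h2 := Nat.ceil_lt_add_one (a := Real.logb 2 ((d : ℝ) + 1))
    (Real.logb_nonneg one_lt_two (by linarith))
  rw [adviceBits]
  push_cast
  linarith

theorem exists_optimal_adviceAlgorithm (V : Type u) {d : ℕ} (hd : 1 ≤ d) :
    ∃ A : AdviceAlgorithm V (adviceBits d), ∀ (m : ℕ) (σ : Fin m → Sym2 V), IsInput σ →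
      IsDegenerate (inputGraph σ) d → IsOptimalColoring σ (A.color σ) := by
  classical
  have S : ∀ (m : ℕ) (σ : Fin m → Sym2 V), IsInput σ ∧ IsDegenerate (inputGraph σ) d →
      Scheme (groupSize d) σ := fun m σ h => (nonempty_scheme hd h.1 h.2).some
  obtain ⟨enc⟩ : Nonempty (((Bool × Bool × Fin (groupSize d)) ⊕ Fin (2 * groupSize d)) ↪
      (Fin (adviceBits d) → Bool)) := by
    rw [Function.Embedding.nonempty_iff_card_le]
    have := six_mul_groupSize_le hd
    simp only [Fintype.card_sum, Fintype.card_prod, Fintype.card_bool, Fintype.card_fin,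
      Fintype.card_fun]
    omega
  obtain ⟨A, hA⟩ := exists_adviceAlgorithm (V := V) (b := adviceBits d)
    (fun m σ => IsInput σ ∧ IsDegenerate (inputGraph σ) d)
    (fun m σ i => if h : IsInput σ ∧ IsDegenerate (inputGraph σ) d then
      enc ((S m σ h).code i) else fun _ => false)
    (fun m σ i => if h : IsInput σ ∧ IsDegenerate (inputGraph σ) d then
      (S m σ h).color i else 0) (by
    intro m m' σ σ' h h' i hi hi' hσ hadv
    simp only [dif_pos h, dif_pos h'] at hadv ⊢
    exact Scheme.color_eq_of_code_eq hi hi' hσ fun j => enc.injective (hadv j))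
  refine ⟨A, fun m σ hσ hσd => ?_⟩
  rw [hA m σ ⟨hσ, hσd⟩]
  simp only [dif_pos (And.intro hσ hσd)]
  exact (S m σ ⟨hσ, hσd⟩).isOptimal

end OnlineEdgeColoring

theorem theorem2 :
    -- the number of bits per edge is `O(log d)`
    ((fun d : ℕ => (OnlineEdgeColoring.adviceBits d : ℝ)) =O[Filter.atTop]
      fun d : ℕ => Real.logb 2 (d : ℝ)) ∧
    ∃ C : ℝ, ∀ (V : Type u) (d : ℕ), 1 ≤ d →
      ∃ A : OnlineEdgeColoring.AdviceAlgorithm V (OnlineEdgeColoring.adviceBits d),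
        ∀ (m : ℕ) (σ : Fin m → Sym2 V), OnlineEdgeColoring.IsInput σ →
          OnlineEdgeColoring.IsDegenerate (OnlineEdgeColoring.inputGraph σ) d →
          -- the colouring produced is optimal
          OnlineEdgeColoring.IsOptimalColoring σ (A.color σ) ∧
          -- the total number of advice bits, and its order
          (A.advice σ).length = m * OnlineEdgeColoring.adviceBits d ∧
          (2 ≤ d → ((A.advice σ).length : ℝ) ≤ C * ((m : ℝ) * Real.logb 2 (d : ℝ))) := by
  refine ⟨Asymptotics.IsBigO.of_bound 7 ?_, 7, fun V d hd => ?_⟩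
  · filter_upwards [Filter.eventually_ge_atTop 2] with d hd
    have h := OnlineEdgeColoring.adviceBits_le hd
    rw [Real.norm_of_nonneg (Nat.cast_nonneg _)]
    exact h.trans (mul_le_mul_of_nonneg_left (Real.le_norm_self _) (by norm_num))
  · obtain ⟨A, hA⟩ := OnlineEdgeColoring.exists_optimal_adviceAlgorithm V hd
    refine ⟨A, fun m σ hσ hσd => ⟨hA m σ hσ hσd, A.length_advice σ, fun h2 => ?_⟩⟩
    rw [A.length_advice σ, Nat.cast_mul, mul_left_comm]
    exact mul_le_mul_of_nonneg_left (OnlineEdgeColoring.adviceBits_le h2) (Nat.cast_nonneg m)
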